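/- Let $N \ge 2$ and $0 \le m < N$ be integers and write $[N] = \{1,\dots,N\}$. A \emph{passive algorithm} for $m$ trajectories of an $N$-state chain is a family of functions $\phi_{k,i} : ([N]^m)^{k+1} \to [0,1]$ ($k \ge 0$, $i \in [N]$) such that $\sum_i \phi_{k,i}(x_0,\dots,x_k) \le 1$ for all $k$ and all $x_0,\dots,x_k \in [N]^m$, and such that $\phi_{k,i}(x_0,\dots,x_k)$ is nondecreasing in $k$ for every $i$ and every sequence $x_0, x_1, \dots \in [N]^m$; here $\phi_{k,i}(x_0,\dots,x_k)$ is the conditional probability that the (possibly randomized) algorithm stops by time $k$ and outputs $i$, given that the positions of the $m$ observed trajectories at times $0,\dots,k$ are $x_0,\dots,x_k$. For a transition matrix $P = (p_{ab})$ on $[N]$ and initial distributions $\rho = (\rho_1,\dots,\rho_m)$ on $[N]$, put $$ F_{k,i}(P,\rho) = \sum_{x_0,\dots,x_k \in [N]^m} \Bigl( \prod_{l=1}^m \rho_l(x_0(l))\, p_{x_0(l),x_1(l)} \cdots p_{x_{k-1}(l),x_k(l)} \Bigr) \phi_{k,i}(x_0,\dots,x_k), \qquad F_k = \sum_{j \in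 [N]} F_{k,j}, $$ which are the probabilities, when the $m$ trajectories are independent, of stopping by time $k$ with output $i$ and of stopping by time $k$. The algorithm is \emph{exact} if, for every irreducible aperiodic $P$, with stationary distribution $\pi$, and all $\rho$, one has $\lim_k F_k(P,\rho) > 0$ and $\lim_k F_{k,i}(P,\rho)/F_k(P,\rho) = \pi_i$ for every $i$. It is \emph{interruptible} if, for all such $P$, $\pi$, $\rho$, one has $F_{k,i}(P,\rho) = \pi_i\, F_k(P,\rho)$ for all $i \in [N]$ and $k \ge 0$ (the output has distribution $\pi$ and is independent of the stopping time). Then no passive algorithm for $m$ trajectories of an $N$-state chain is both exact and interruptible. In particular (the case $m = 1$), there is none that uses a single trajectory. -/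

import Mathlib

open Filter Topology

/-- `P` is aperiodic: for every state `i`, the greatest common divisor of the possible return
times `{n ≥ 1 : (P ^ n) i i > 0}` is `1`. -/
def IsAperiodic {N : ℕ} (P : Matrix (Fin N) (Fin N) ℝ) : Prop :=
  ∀ i : Fin N, ∀ d : ℕ, (∀ n : ℕ, 1 ≤ n → 0 < (P ^ n) i i → d ∣ n) → d = 1

/-- `P` is the transition matrix of an irreducible aperiodic Markov chain on `N` states. -/
structure IsErgodicTransition {N : ℕ} (P : Matrix (Fin N) (Fin N) ℝ) : Prop where
  stochastic : P ∈ Matrix.rowStochastic ℝ (Fin N)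
  irreducible : P.IsIrreducible
  aperiodic : IsAperiodic P

/-- The probability distribution `π` is stationary for `P`, that is, `π P = π`. -/
structure IsStationaryDistribution {N : ℕ} (P : Matrix (Fin N) (Fin N) ℝ) (π : Fin N → ℝ) :
    Prop where
  isDistribution : π ∈ stdSimplex ℝ (Fin N)
  invariant : Matrix.vecMul π P = π

/-- The probability that `m` independent trajectories of the chain with transition matrix `P`,
the `l`-th one having initial distribution `ρ l`, are equal to `x 0, …, x k` at the times
`0, …, k`. Here `x t l` is the position of the `l`-th trajectory at time `t`. -/
noncomputable def pathProb {N m : ℕ} (P : Matrix (Fin N) (Fin N) ℝ) (ρ : Fin m → Fin N → ℝ)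
    {k : ℕ} (x : Fin (k + 1) → Fin m → Fin N) : ℝ :=
  ∏ l : Fin m, (ρ l (x 0 l) * ∏ t : Fin k, P (x t.castSucc l) (x t.succ l))

/-- A (possibly randomized) stopping rule with output in the state space, for an observer who
watches `m` trajectories in an `N`-element state space without influencing them.
`φ k i x` is the conditional probability that the observer has stopped by time `k` with output
`i`, given that the positions at the times `0, …, k` are `x 0, …, x k`. -/
structure PassiveAlgorithm (N m : ℕ) where
  φ : (k : ℕ) → Fin N → (Fin (k + 1) → Fin m → Fin N) → ℝ
  nonneg : ∀ k i x, 0 ≤ φ k i x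
  sum_le_one : ∀ k x, ∑ i, φ k i x ≤ 1
  mono : ∀ (i : Fin N) (x : ℕ → Fin m → Fin N),
    Monotone fun k : ℕ => φ k i fun t : Fin (k + 1) => x t

namespace PassiveAlgorithm

/-- The probability that the algorithm has stopped by time `k` with output `i`. -/
noncomputable def outputProb {N m : ℕ} (A : PassiveAlgorithm N m)
    (P : Matrix (Fin N) (Fin N) ℝ) (ρ : Fin m → Fin N → ℝ) (k : ℕ) (i : Fin N) : ℝ :=
  ∑ x : Fin (k + 1) → Fin m → Fin N, pathProb P ρ x * A.φ k i x

/-- The probability that the algorithm has stopped by time `k`. -/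
noncomputable def stopProb {N m : ℕ} (A : PassiveAlgorithm N m)
    (P : Matrix (Fin N) (Fin N) ℝ) (ρ : Fin m → Fin N → ℝ) (k : ℕ) : ℝ :=
  ∑ j : Fin N, A.outputProb P ρ k j

/-- The algorithm is exact: whatever the irreducible aperiodic chain and the initial
distributions, it stops with positive probability, and conditionally on its ever stopping the
output has the stationary distribution. -/
def IsExact {N m : ℕ} (A : PassiveAlgorithm N m) : Prop :=
  ∀ (P : Matrix (Fin N) (Fin N) ℝ) (π : Fin N → ℝ) (ρ : Fin m → Fin N → ℝ),
    IsErgodicTransition P → IsStationaryDistribution P π →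
    (∀ l, ρ l ∈ stdSimplex ℝ (Fin N)) →
      (∃ L : ℝ, 0 < L ∧ Tendsto (A.stopProb P ρ) atTop (𝓝 L)) ∧
      ∀ i : Fin N,
        Tendsto (fun k => A.outputProb P ρ k i / A.stopProb P ρ k) atTop (𝓝 (π i))

/-- The algorithm is interruptible: whatever the irreducible aperiodic chain and the initial
distributions, the output has the stationary distribution and is independent of the stopping
time. -/
def IsInterruptible {N m : ℕ} (A : PassiveAlgorithm N m) : Prop :=
  ∀ (P : Matrix (Fin N) (Fin N) ℝ) (π : Fin N → ℝ) (ρ : Fin m → Fin N → ℝ),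
    IsErgodicTransition P → IsStationaryDistribution P π →
    (∀ l, ρ l ∈ stdSimplex ℝ (Fin N)) →
      ∀ (i : Fin N) (k : ℕ), A.outputProb P ρ k i = π i * A.stopProb P ρ k

end PassiveAlgorithm

/-!
An interruptible algorithm satisfies `F_{k,i} = π_i F_k` for every chain, so for two chains `P`, `P'`
the ratios `F'_{k,i} / F_{k,i}` reproduce, up to a factor that does not depend on `i`, the ratios
`π'_i / π_i`. The proof exhibits two chains for which these ratios vary too much with `i`.

Suppose that, off the diagonal, `P' i j * d i = P i j * d j` for a positive function `d` of the
state. Along a trajectory the factors `d j / d i` telescope, so that only the two endpoints matter: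
the probability of a trajectory changes by `d (end) / d (start)`. The diagonal entries are not
related by such an identity, but if both chains are slowed down (transition probabilities
proportional to `ε → 0`, which leaves `π` unchanged), they tend to `1` and contribute a factor close
to `1` over a fixed time `k`. This is `pathProb_le` and `outputProb_le`. With `d = lam` at the
state `0` and `d = 1` elsewhere, and all trajectories starting outside `0`, the ratios
`F'_{k,i} / F_{k,i}` lie essentially between `1` and `lam ^ m`: a trajectory can gain a factor `lam`
only by ending at `0`.

On the other hand, `cycleChain` walks along `0 → 1 → ⋯ → N - 1` and may jump back to `0` from
everywhere. Raising the rate of all jumps to `0` by the factor `lam` and lowering the rate out of `0`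
by the same factor is the gauge transformation by `d`. By the Markov chain tree theorem, `π_0` and
`π_{N-1}` are proportional to sums over the spanning trees rooted at these states. The star at `0`
consists of `N - 1` jumps to `0`, while the only tree rooted at `N - 1` is the path, which has one
edge out of `0` and none into it. So `π_0 / π_{N-1}` grows like `lam ^ N`; here this is read off from
the explicit invariant measure `cycleWeight` (`isStationary_cycleChain`). For `m < N` and large
`lam` this is incompatible with the bound `lam ^ m`. Exactness is used only to supply a time `k` at
which the algorithm has stopped with positive probability.
-/

open Finset Matrix

/-! ### Comparing the behaviour of an algorithm under two chains -/

/-- If `Q i j ≤ K * P i j * (d j / d i)` for all `i`, `j`, then the factors `d j / d i` telescope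
along a path and the product of the transition probabilities is controlled by the values of `d` at
its endpoints. -/
lemma prod_transition_le {N : ℕ} {P Q : Matrix (Fin N) (Fin N) ℝ} {d : Fin N → ℝ} {K : ℝ}
    (hK : 0 ≤ K) (hP : ∀ i j, 0 ≤ P i j) (hQ : ∀ i j, 0 ≤ Q i j)
    (h : ∀ i j, Q i j * d i ≤ K * (P i j * d j)) (k : ℕ) (y : Fin (k + 1) → Fin N) :
    (∏ t : Fin k, Q (y t.castSucc) (y t.succ)) * d (y 0) ≤
      K ^ k * ((∏ t : Fin k, P (y t.castSucc) (y t.succ)) * d (y (Fin.last k))) := by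
  induction k with
  | zero => simp
  | succ k ih =>
    have ih' := ih fun t => y t.castSucc
    rw [Fin.prod_univ_castSucc, Fin.prod_univ_castSucc, Fin.succ_last]
    simp only [← Fin.castSucc_succ, Fin.castSucc_zero] at ih' ⊢
    set A := ∏ t : Fin k, Q (y t.castSucc.castSucc) (y t.succ.castSucc)
    set B := ∏ t : Fin k, P (y t.castSucc.castSucc) (y t.succ.castSucc)
    have hB : 0 ≤ K ^ k * B := mul_nonneg (pow_nonneg hK k) (prod_nonneg fun _ _ => hP _ _)
    set a := y (Fin.last k).castSucc
    set b := y (Fin.last (k + 1))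
    calc A * Q a b * d (y 0) = A * d (y 0) * Q a b := by ring
      _ ≤ K ^ k * (B * d a) * Q a b := mul_le_mul_of_nonneg_right ih' (hQ a b)
      _ = K ^ k * B * (Q a b * d a) := by ring
      _ ≤ K ^ k * B * (K * (P a b * d b)) := mul_le_mul_of_nonneg_left (h a b) hB
      _ = K ^ (k + 1) * (B * P a b * d b) := by ring

/-- When all trajectories start at a state where `d = 1`, each of them contributes at most the
factor `K ^ k` and the value of `d` at its endpoint. -/
lemma pathProb_le {N m : ℕ} {P Q : Matrix (Fin N) (Fin N) ℝ} {d : Fin N → ℝ} {K B : ℝ}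
    {s : Fin N} (hK : 0 ≤ K) (hP : ∀ i j, 0 ≤ P i j) (hQ : ∀ i j, 0 ≤ Q i j)
    (h : ∀ i j, Q i j * d i ≤ K * (P i j * d j)) (hs : d s = 1) (hd : ∀ i, d i ≤ B)
    {k : ℕ} (x : Fin (k + 1) → Fin m → Fin N) :
    pathProb Q (fun _ => Pi.single s 1) x ≤
      (K ^ k * B) ^ m * pathProb P (fun _ => Pi.single s 1) x := by
  have hsingle (i : Fin N) : (0 : ℝ) ≤ (Pi.single s 1 : Fin N → ℝ) i := by
    by_cases hi : i = s
    · subst hi; simp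
    · simp [hi]
  have hconst : (K ^ k * B) ^ m = ∏ _l : Fin m, K ^ k * B := by simp
  rw [pathProb, pathProb, hconst, ← prod_mul_distrib]
  refine prod_le_prod (fun l _ => mul_nonneg (hsingle _) (prod_nonneg fun _ _ => hQ _ _))
    fun l _ => ?_
  by_cases hx : x 0 l = s
  · have hpath := prod_transition_le hK hP hQ h k fun t => x t l
    simp only [hx, hs, mul_one, Pi.single_eq_same, one_mul] at hpath ⊢
    refine hpath.trans ?_
    rw [mul_assoc, mul_comm B]
    exact mul_le_mul_of_nonneg_left
      (mul_le_mul_of_nonneg_left (hd _) (prod_nonneg fun _ _ => hP _ _)) (pow_nonneg hK k)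
  · simp [hx]

lemma outputProb_le {N m : ℕ} (A : PassiveAlgorithm N m) {P Q : Matrix (Fin N) (Fin N) ℝ}
    {d : Fin N → ℝ} {K B : ℝ} {s : Fin N} (hK : 0 ≤ K) (hP : ∀ i j, 0 ≤ P i j)
    (hQ : ∀ i j, 0 ≤ Q i j) (h : ∀ i j, Q i j * d i ≤ K * (P i j * d j)) (hs : d s = 1)
    (hd : ∀ i, d i ≤ B) (k : ℕ) (i : Fin N) :
    A.outputProb Q (fun _ => Pi.single s 1) k i ≤
      (K ^ k * B) ^ m * A.outputProb P (fun _ => Pi.single s 1) k i := by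
  rw [PassiveAlgorithm.outputProb, PassiveAlgorithm.outputProb, mul_sum]
  refine sum_le_sum fun x _ => ?_
  rw [← mul_assoc]
  exact mul_le_mul_of_nonneg_right (pathProb_le hK hP hQ h hs hd x) (A.nonneg k i x)

/-! ### The cycle with resets -/

/-- Off-diagonal transition rates on `n + 2` states: every state `i ≠ 0` jumps to `0` at rate `lam`,
and every state `i` other than the last one moves to `i + 1`, at rate `lam⁻¹` if `i = 0` and at
rate `1` otherwise. -/
noncomputable def cycleRate (n : ℕ) (lam : ℝ) (i j : Fin (n + 2)) : ℝ :=
  if j = 0 then if i = 0 then 0 else lam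
  else if (j : ℕ) = i + 1 then if i = 0 then lam⁻¹ else 1 else 0

/-- The total rate `∑ j, cycleRate n lam i j` out of the state `i`, in closed form. -/
noncomputable def cycleExitRate (n : ℕ) (lam : ℝ) (i : Fin (n + 2)) : ℝ :=
  if i = 0 then lam⁻¹ else if i = Fin.last (n + 1) then lam else lam + 1

/-- The discrete-time chain that makes the transitions of `cycleRate` with probabilities `ε` times
the rates, and stays put otherwise. -/
noncomputable def cycleChain (n : ℕ) (lam ε : ℝ) : Matrix (Fin (n + 2)) (Fin (n + 2)) ℝ :=
  fun i j => if i = j then 1 - ε * cycleExitRate n lam i else ε * cycleRate n lam i j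

/-- An invariant measure of `cycleChain`, not normalized; it does not depend on `ε`. -/
noncomputable def cycleWeight (n : ℕ) (lam : ℝ) (i : Fin (n + 2)) : ℝ :=
  if i = 0 then lam ^ 2 * (lam + 1) ^ n
  else if i = Fin.last (n + 1) then 1 else lam * (lam + 1) ^ (n - i)

section

variable {n : ℕ} {lam ε : ℝ}

lemma cycleRate_self (i : Fin (n + 2)) : cycleRate n lam i i = 0 := by
  unfold cycleRate
  split_ifs <;> first | rfl | omega

lemma cycleRate_nonneg (hlam : 0 ≤ lam) (i j : Fin (n + 2)) : 0 ≤ cycleRate n lam i j := by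
  unfold cycleRate
  split_ifs <;> positivity

lemma sum_cycleRate (i : Fin (n + 2)) : ∑ j, cycleRate n lam i j = cycleExitRate n lam i := by
  rw [Fin.sum_univ_succ]
  have hsucc (j : Fin (n + 1)) : cycleRate n lam i j.succ =
      if j.castSucc = i then if i = 0 then lam⁻¹ else 1 else 0 := by
    simp [cycleRate, Fin.ext_iff (a := j.castSucc)]
  simp only [hsucc]
  induction i using Fin.lastCases with
  | last => simp [cycleRate, cycleExitRate, Fin.castSucc_ne_last]
  | cast i =>
    simp only [Fin.castSucc_inj, Finset.sum_ite_eq', mem_univ, if_true]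
    by_cases hi : i = 0
    · subst hi; simp [cycleRate, cycleExitRate]
    · simp [cycleRate, cycleExitRate, hi, Fin.castSucc_ne_last]

lemma cycleExitRate_nonneg (hlam : 0 ≤ lam) (i : Fin (n + 2)) : 0 ≤ cycleExitRate n lam i := by
  unfold cycleExitRate
  split_ifs <;> positivity

lemma cycleExitRate_le (hlam : 1 ≤ lam) (i : Fin (n + 2)) : cycleExitRate n lam i ≤ lam + 1 := by
  have := inv_le_one_of_one_le₀ hlam
  unfold cycleExitRate
  split_ifs <;> linarith

lemma le_cycleChain_self (hlam : 1 ≤ lam) (hε : 0 ≤ ε) (i : Fin (n + 2)) :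
    1 - ε * (lam + 1) ≤ cycleChain n lam ε i i := by
  have := mul_le_mul_of_nonneg_left (cycleExitRate_le hlam i) hε
  simp only [cycleChain, if_true]
  linarith

lemma cycleChain_nonneg (hlam : 1 ≤ lam) (hε : 0 ≤ ε) (hlε : ε * (lam + 1) < 1)
    (i j : Fin (n + 2)) : 0 ≤ cycleChain n lam ε i j := by
  by_cases h : i = j
  · subst h
    linarith [le_cycleChain_self (n := n) hlam hε i]
  · simp only [cycleChain, h, if_false]
    exact mul_nonneg hε (cycleRate_nonneg (by linarith) i j)

lemma cycleChain_eq (i j : Fin (n + 2)) : cycleChain n lam ε i j =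
    (if i = j then 1 - ε * cycleExitRate n lam i else 0) + ε * cycleRate n lam i j := by
  by_cases h : i = j
  · subst h; simp [cycleChain, cycleRate_self]
  · simp [cycleChain, h]

lemma sum_cycleChain (i : Fin (n + 2)) : ∑ j, cycleChain n lam ε i j = 1 := by
  simp [cycleChain_eq, sum_add_distrib, ← mul_sum, sum_cycleRate]

lemma isIrreducible_cycleChain (hlam : 1 ≤ lam) (hε : 0 < ε) (hlε : ε * (lam + 1) < 1) :
    (cycleChain n lam ε).IsIrreducible := by
  have hnn := cycleChain_nonneg (n := n) hlam hε.le hlε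
  rw [isIrreducible_iff_exists_pow_pos hnn]
  have hstep {k : ℕ} {i j l : Fin (n + 2)} (h₁ : 0 < (cycleChain n lam ε ^ k) i j)
      (h₂ : 0 < cycleChain n lam ε j l) : 0 < (cycleChain n lam ε ^ (k + 1)) i l := by
    rw [pow_succ, mul_apply]
    exact sum_pos' (fun a _ => mul_nonneg (pow_apply_nonneg hnn k i a) (hnn a l))
      ⟨j, mem_univ j, mul_pos h₁ h₂⟩
  have hlam0 : 0 < lam := by linarith
  intro i j
  induction j using Fin.induction with
  | zero =>
    refine ⟨1, one_pos, ?_⟩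
    rw [pow_one]
    by_cases hi : i = 0
    · subst hi
      linarith [le_cycleChain_self (n := n) hlam hε.le 0]
    · simp only [cycleChain, cycleRate, hi, if_true, if_false]
      positivity
  | succ j ih =>
    obtain ⟨k, -, hk⟩ := ih
    refine ⟨k + 1, k.succ_pos, hstep hk ?_⟩
    have hne : j.castSucc ≠ j.succ := j.castSucc_lt_succ.ne
    simp only [cycleChain, cycleRate, hne, Fin.succ_ne_zero, Fin.val_succ, Fin.val_castSucc,
      if_true, if_false]
    split_ifs <;> positivity

lemma isErgodic_cycleChain (hlam : 1 ≤ lam) (hε : 0 < ε) (hlε : ε * (lam + 1) < 1) :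
    IsErgodicTransition (cycleChain n lam ε) where
  stochastic :=
    mem_rowStochastic_iff_sum.2 ⟨cycleChain_nonneg hlam hε.le hlε, sum_cycleChain⟩
  irreducible := isIrreducible_cycleChain hlam hε hlε
  aperiodic i d hd := by
    refine Nat.dvd_one.1 (hd 1 le_rfl ?_)
    rw [pow_one]
    linarith [le_cycleChain_self (n := n) hlam hε.le i]

lemma cycleWeight_pos (hlam : 0 < lam) (i : Fin (n + 2)) : 0 < cycleWeight n lam i := by
  unfold cycleWeight
  split_ifs <;> positivity

/-- The flow balance at a state other than `0`, whose only entrance is its predecessor. -/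
lemma sum_cycleWeight_mul_cycleRate (hlam : lam ≠ 0) (j : Fin (n + 1)) :
    ∑ i, cycleWeight n lam i * cycleRate n lam i j.succ =
      cycleWeight n lam j.succ * cycleExitRate n lam j.succ := by
  rw [sum_eq_single j.castSucc]
  · trans lam * (lam + 1) ^ (n - j)
    · by_cases hj : j = 0
      · subst hj
        simp only [cycleWeight, cycleRate, Fin.castSucc_zero, Fin.succ_ne_zero, Fin.val_succ,
          Fin.val_zero, if_true, if_false, Nat.sub_zero]
        field_simp
      · have : j.castSucc ≠ 0 := by simpa using hj
        simp [cycleWeight, cycleRate, hj, Fin.castSucc_ne_last]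
    · induction j using Fin.lastCases with
      | last => simp [cycleWeight, cycleExitRate]
      | cast j =>
        have hj : n - (j : ℕ) = n - (j + 1) + 1 := by omega
        have hl : j.castSucc.succ ≠ Fin.last (n + 1) := by
          rw [Fin.ne_iff_vne]; simp; omega
        simp only [cycleWeight, cycleExitRate, Fin.succ_ne_zero, hl, if_false, Fin.val_succ,
          Fin.val_castSucc, hj, pow_succ]
        ring
  · intro i _ hi
    have : (j : ℕ) ≠ i := fun h => hi (Fin.ext (by simp [h]))
    simp [cycleRate, this]
  · simp

lemma vecMul_cycleWeight (hlam : lam ≠ 0) :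
    vecMul (cycleWeight n lam) (cycleChain n lam ε) = cycleWeight n lam := by
  have happ (j : Fin (n + 2)) : vecMul (cycleWeight n lam) (cycleChain n lam ε) j =
      cycleWeight n lam j * (1 - ε * cycleExitRate n lam j) +
        ε * ∑ i, cycleWeight n lam i * cycleRate n lam i j := by
    simp [vecMul, dotProduct, cycleChain_eq, mul_add, sum_add_distrib, mul_sum, mul_left_comm]
  have hsucc (j : Fin (n + 1)) : vecMul (cycleWeight n lam) (cycleChain n lam ε) j.succ =
      cycleWeight n lam j.succ := by
    rw [happ, sum_cycleWeight_mul_cycleRate hlam]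
    ring
  -- The chain preserves the total mass, so balance at the other states gives balance at `0`.
  have htotal : ∑ j, vecMul (cycleWeight n lam) (cycleChain n lam ε) j =
      ∑ j, cycleWeight n lam j := by
    simp only [vecMul, dotProduct]
    rw [sum_comm]
    simp [← mul_sum, sum_cycleChain]
  rw [Fin.sum_univ_succ, Fin.sum_univ_succ (cycleWeight n lam)] at htotal
  simp only [hsucc, add_left_inj] at htotal
  funext j
  cases j using Fin.cases with
  | zero => exact htotal
  | succ j => exact hsucc j

lemma isStationary_cycleChain (hlam : 0 < lam) :
    IsStationaryDistribution (cycleChain n lam ε)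
      ((∑ i, cycleWeight n lam i)⁻¹ • cycleWeight n lam) where
  isDistribution := by
    have hS : 0 < ∑ i, cycleWeight n lam i :=
      sum_pos (fun i _ => cycleWeight_pos hlam i) univ_nonempty
    refine ⟨fun i => mul_nonneg (inv_nonneg.2 hS.le) (cycleWeight_pos hlam i).le, ?_⟩
    simp only [Pi.smul_apply, smul_eq_mul, ← mul_sum]
    exact inv_mul_cancel₀ hS.ne'
  invariant := by rw [smul_vecMul, vecMul_cycleWeight hlam.ne']

/-- Changing the parameter from `mu` to `lam` is, off the diagonal, a gauge transformation by the
function equal to `lam / mu` at `0` and to `1` elsewhere. -/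
lemma cycleRate_mul_gauge {mu : ℝ} (hlam : lam ≠ 0) (hmu : mu ≠ 0) (i j : Fin (n + 2)) :
    cycleRate n lam i j * (if i = 0 then lam / mu else 1) =
      cycleRate n mu i j * (if j = 0 then lam / mu else 1) := by
  unfold cycleRate
  split_ifs <;> first | (simp; done) | field_simp

lemma cycleChain_mul_gauge_le {mu δ : ℝ} (hlam : 1 ≤ lam) (hmu : 1 ≤ mu) (hε : 0 ≤ ε)
    (hδ : δ < 1) (hmuδ : ε * (mu + 1) ≤ δ) (i j : Fin (n + 2)) :
    cycleChain n lam ε i j * (if i = 0 then lam / mu else 1) ≤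
      (1 - δ)⁻¹ * (cycleChain n mu ε i j * (if j = 0 then lam / mu else 1)) := by
  have hpos : 0 < 1 - δ := by linarith
  have hδ0 : 0 ≤ δ := le_trans (by positivity) hmuδ
  by_cases h : i = j
  · subst h
    rw [← mul_assoc]
    refine mul_le_mul_of_nonneg_right ?_ (by split_ifs <;> positivity)
    have h₁ : cycleChain n lam ε i i ≤ 1 := by
      have := mul_nonneg hε (cycleExitRate_nonneg (n := n) (lam := lam) (by linarith) i)
      simp only [cycleChain, if_true]
      linarith
    have h₂ : 1 - δ ≤ cycleChain n mu ε i i := by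
      linarith [le_cycleChain_self (n := n) hmu hε i]
    rw [inv_mul_eq_div, le_div_iff₀ hpos]
    nlinarith
  · have hgauge := cycleRate_mul_gauge (n := n) (show lam ≠ 0 by linarith)
      (show mu ≠ 0 by linarith) i j
    simp only [cycleChain, h, if_false]
    rw [mul_assoc, hgauge, ← mul_assoc]
    refine le_mul_of_one_le_left (mul_nonneg (mul_nonneg hε (cycleRate_nonneg (by linarith) i j))
      (by split_ifs <;> positivity)) ((one_le_inv₀ hpos).2 (by linarith))

/-- The chain with larger `ε` is dominated entrywise by a multiple of the one with smaller `ε`, so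
whatever the algorithm does with positive probability on the former it does on the latter. -/
lemma cycleChain_le_mul {ε₀ : ℝ} (hlam : 1 ≤ lam) (hε : 0 < ε) (hεε₀ : ε ≤ ε₀)
    (hlε₀ : ε₀ * (lam + 1) < 1) (i j : Fin (n + 2)) :
    cycleChain n lam ε₀ i j ≤ ε₀ / ε * cycleChain n lam ε i j := by
  by_cases h : i = j
  · have he := cycleExitRate_nonneg (n := n) (lam := lam) (by linarith) i
    have hle := cycleExitRate_le (n := n) hlam i
    have h₁ : ε * cycleExitRate n lam i ≤ ε₀ * cycleExitRate n lam i := by gcongr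
    have h₂ : ε₀ * cycleExitRate n lam i ≤ ε₀ * (lam + 1) :=
      mul_le_mul_of_nonneg_left hle (by linarith)
    simp only [cycleChain, h, if_true]
    subst h
    exact (sub_le_sub_left h₁ 1).trans
      (le_mul_of_one_le_left (by linarith) ((one_le_div hε).2 hεε₀))
  · simp only [cycleChain, h, if_false]
    rw [← mul_assoc, div_mul_cancel₀ _ hε.ne']

end

/-! ### Impossibility -/

/-- The invariant measure of the state `0` relative to the last state, which has weight `1`. -/
lemma pow_le_cycleWeight_zero (n : ℕ) {lam : ℝ} (hlam : 0 ≤ lam) :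
    lam ^ (n + 2) ≤ cycleWeight n lam 0 := by
  simp only [cycleWeight, if_true]
  rw [pow_add, mul_comm]
  gcongr
  linarith

/-- A slowing-down factor `1 - δ` so close to `1` that its `M`-th power is at least `1 / 2`. -/
lemma exists_inv_one_sub_pow_le_two (M : ℕ) :
    ∃ δ : ℝ, 0 < δ ∧ δ ≤ 1 / 2 ∧ (1 - δ)⁻¹ ^ M ≤ 2 := by
  have hM : (0 : ℝ) < 2 * (M + 1) := by positivity
  have hle : ((2 : ℝ) * (M + 1))⁻¹ ≤ 1 / 2 := by
    rw [inv_le_comm₀ hM (by norm_num)]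
    linarith [M.cast_nonneg (α := ℝ)]
  refine ⟨(2 * (M + 1))⁻¹, inv_pos.2 hM, hle, ?_⟩
  have hbern := one_add_mul_le_pow (a := -((2 : ℝ) * (M + 1))⁻¹) (by linarith) M
  have hhalf : (M : ℝ) * ((2 : ℝ) * (M + 1))⁻¹ ≤ 1 / 2 := by
    rw [← div_eq_mul_inv, div_le_iff₀ hM]
    linarith
  rw [inv_pow]
  refine inv_le_of_inv_le₀ two_pos ?_
  rw [sub_eq_add_neg]
  linarith

theorem theoremT (N m : ℕ) (hN : 2 ≤ N) (hm : m < N) :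
    ¬ ∃ A : PassiveAlgorithm N m, A.IsExact ∧ A.IsInterruptible := by
  rintro ⟨A, hexact, hint⟩
  obtain ⟨n, rfl⟩ := Nat.exists_eq_add_of_le' hN
  have hl : Fin.last (n + 1) ≠ 0 := Fin.last_pos.ne'
  -- All trajectories start at a state other than `0`.
  set ρ : Fin m → Fin (n + 2) → ℝ := fun _ => Pi.single (Fin.last (n + 1)) 1 with hρdef
  have hρ (l : Fin m) : ρ l ∈ stdSimplex ℝ (Fin (n + 2)) := single_mem_stdSimplex ℝ _
  -- The time `k` has to be fixed before `ε`, which depends on it; hence the auxiliary chain with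
  -- `ε = 1 / 4`.
  obtain ⟨k, hk⟩ : ∃ k, 0 < A.stopProb (cycleChain n 1 (1 / 4)) ρ k := by
    obtain ⟨⟨L, hL, hlim⟩, -⟩ := hexact _ _ ρ
      (isErgodic_cycleChain (n := n) (lam := 1) (ε := 1 / 4) le_rfl (by norm_num) (by norm_num))
      (isStationary_cycleChain one_pos) hρ
    exact (hlim.eventually (lt_mem_nhds hL)).exists
  obtain ⟨δ, hδ0, hδ, hpow⟩ := exists_inv_one_sub_pow_le_two (k * m * 2)
  -- The bounds below give `lam ^ (n + 2) ≤ 2 * lam ^ m * 2 ^ n`, so any `lam > 2 ^ (n + 1)` will do.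
  obtain ⟨lam, hlam_eq⟩ : ∃ lam : ℝ, lam = 2 ^ (n + 2) := ⟨_, rfl⟩
  have hlam : 1 ≤ lam := hlam_eq ▸ one_le_pow₀ one_le_two
  have hlam0 : 0 < lam := by linarith
  obtain ⟨ε, hε_eq⟩ : ∃ ε : ℝ, ε = δ / (lam + 1) := ⟨_, rfl⟩
  have hε : 0 < ε := by rw [hε_eq]; positivity
  have hlδ : ε * (lam + 1) = δ := by rw [hε_eq]; field_simp
  have h1δ : ε * (1 + 1) ≤ δ := by rw [← hlδ]; gcongr
  have hP := cycleChain_nonneg (n := n) le_rfl hε.le (by linarith : ε * (1 + 1) < 1)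
  have hP' := cycleChain_nonneg (n := n) hlam hε.le (by linarith : ε * (lam + 1) < 1)
  set P := cycleChain n 1 ε
  set P' := cycleChain n lam ε
  have hF : 0 < A.stopProb P ρ k := by
    have hle : A.stopProb (cycleChain n 1 (1 / 4)) ρ k ≤
        ((1 / 4 / ε) ^ k * 1) ^ m * A.stopProb P ρ k := by
      rw [PassiveAlgorithm.stopProb, PassiveAlgorithm.stopProb, mul_sum]
      exact sum_le_sum fun i _ => outputProb_le A (d := 1) (by positivity) hP
        (cycleChain_nonneg le_rfl (by norm_num) (by norm_num))
        (fun i j => by simpa using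
          cycleChain_le_mul (n := n) le_rfl hε (by linarith) (by norm_num) i j)
        rfl (fun _ => le_rfl) k i
    exact pos_of_mul_pos_right (hk.trans_le hle) (by positivity)
  have hK : 0 ≤ (1 - δ)⁻¹ := inv_nonneg.2 (by linarith)
  -- Output `0` gains at most `lam ^ m` from `P` to `P'`, and the last state essentially never loses.
  have hzero := outputProb_le A hK hP hP'
    (cycleChain_mul_gauge_le hlam le_rfl hε.le (by linarith) h1δ) (if_neg hl)
    (B := lam) (fun i => by split_ifs <;> simp [hlam]) k 0
  have hlast := outputProb_le A hK hP' hP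
    (cycleChain_mul_gauge_le le_rfl hlam hε.le (by linarith) hlδ.le) (if_neg hl)
    (B := 1) (fun i => by split_ifs <;> simp [inv_le_one_of_one_le₀ hlam]) k (Fin.last (n + 1))
  have hint₁ := hint P _ ρ (isErgodic_cycleChain le_rfl hε (by linarith))
    (isStationary_cycleChain one_pos) hρ
  have hint' := hint P' _ ρ (isErgodic_cycleChain hlam hε (by linarith))
    (isStationary_cycleChain hlam0) hρ
  rw [← hρdef, hint₁, hint'] at hzero hlast
  set S := ∑ i, cycleWeight n 1 i
  set S' := ∑ i, cycleWeight n lam i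
  have hS : 0 < S := sum_pos (fun i _ => cycleWeight_pos one_pos i) univ_nonempty
  have hwl (x : ℝ) : cycleWeight n x (Fin.last (n + 1)) = 1 := by simp [cycleWeight]
  have hw0 : cycleWeight n 1 0 = 2 ^ n := by simp [cycleWeight]; norm_num
  have hw0' := pow_le_cycleWeight_zero n hlam0.le
  simp only [Pi.smul_apply, smul_eq_mul, hwl, hw0, mul_one] at hzero hlast
  have hw0'_nonneg : 0 ≤ cycleWeight n lam 0 := (cycleWeight_pos hlam0 0).le
  set W := cycleWeight n lam 0
  set C := ((1 - δ)⁻¹ ^ k) ^ m with hC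
  have hC0 : 0 ≤ C := by positivity
  have hC2 : C ^ 2 ≤ 2 := by rwa [hC, ← pow_mul, ← pow_mul, ← mul_assoc]
  rw [mul_pow, ← hC] at hzero
  set X := S'⁻¹ * A.stopProb P' ρ k with hX
  set Y := S⁻¹ * A.stopProb P ρ k with hY
  have hY0 : 0 < Y := mul_pos (inv_pos.2 hS) hF
  have hWY : W * Y ≤ C ^ 2 * lam ^ m * 2 ^ n * Y :=
    calc W * Y ≤ W * (C * X) := mul_le_mul_of_nonneg_left hlast hw0'_nonneg
      _ = C * (S'⁻¹ * W * A.stopProb P' ρ k) := by rw [hX]; ring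
      _ ≤ C * (C * lam ^ m * (S⁻¹ * 2 ^ n * A.stopProb P ρ k)) :=
        mul_le_mul_of_nonneg_left hzero hC0
      _ = C ^ 2 * lam ^ m * 2 ^ n * Y := by rw [hY]; ring
  have hW : W ≤ C ^ 2 * lam ^ m * 2 ^ n := le_of_mul_le_mul_right hWY hY0
  have hupper : lam ^ (n + 1) * lam ≤ lam ^ (n + 1) * 2 ^ (n + 1) :=
    calc lam ^ (n + 1) * lam ≤ C ^ 2 * lam ^ m * 2 ^ n := by
          rw [← pow_succ]; exact hw0'.trans hW
      _ ≤ 2 * lam ^ (n + 1) * 2 ^ n := by gcongr; omega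
      _ = lam ^ (n + 1) * 2 ^ (n + 1) := by ring
  have hcontra : lam ≤ 2 ^ (n + 1) := le_of_mul_le_mul_left hupper (by positivity)
  rw [hlam_eq] at hcontra
  exact absurd hcontra (not_le.2 (pow_lt_pow_right₀ one_lt_two (by omega)))
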